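/- For subsets $S,T\subset GL(N,\mathbb C)$ write $S\subset_{\mathrm{Int}}T$ if $g^{-1}Sg\subset T$ for some $g\in GL(N,\mathbb C)$. Let $$I_{p,q}=\begin{pmatrix}I_p&0\\0&-I_q\end{pmatrix},\qquad J_N=\begin{pmatrix}0&-I_{N/2}\\I_{N/2}&0\end{pmatrix}\ (N\text{ even}).$$ Put $O(N,\mathbb C)=\{g\in GL(N,\mathbb C)\mid {}^tg\,g=I_N\}$ and $O(p,q)=\{g\in GL(N,\mathbb R)\mid {}^tg\,I_{p,q}\,g=I_{p,q}\}$ $(p+q=N)$. For even $N$ put $Sp(N/2,\mathbb F)=\{g\in GL(N,\mathbb F)\mid {}^tg\,J_N\,g=J_N\}$ for $\mathbb F=\mathbb R,\mathbb C$; $Sp(r,s)=\{g\in GL(N/2,\mathbb H)\mid g^*I_{r,s}\,g=I_{r,s}\}$ $(r+s=N/2)$; and $O^*(2(N/2))=\{g\in GL(N/2,\mathbb H)\mid g^*(\mathbf jI_{N/2})\,g=\mathbf jI_{N/2}\}$, where $\mathbb H$ denotes the quaternions and $g^*$ the quaternionic conjugate transpose. Regard $GL(N,\mathbb R)$ as a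 subgroup of $GL(N,\mathbb C)$ in the obvious way and, for even $N$, $GL(N/2,\mathbb H)$ as a subgroup of $GL(N,\mathbb C)$ by $Z+W\mathbf j\mapsto\begin{pmatrix}Z&W\\-\overline W&\overline Z\end{pmatrix}$ with $Z,W\in M(N/2,\mathbb C)$; all the groups above are then subgroups of $GL(N,\mathbb C)$. **Proposition.** Let $N\in\mathbb N$ and let $\tau\colon L\to GL(N,\mathbb C)$ be a continuous representation of a Lie group $L$. Then 1. there exist $p,q\in\mathbb N$ with $p+q=N$ and $\operatorname{Im}\tau\subset_{\mathrm{Int}}O(p,q)$ if and only if both $\operatorname{Im}\tau\subset_{\mathrm{Int}}O(N,\mathbb C)$ and $\operatorname{Im}\tau\subset_{\mathrm{Int}}GL(N,\mathbb R)$. If moreover $N$ is even, then 2. $\operatorname{Im}\tau\subset_{\mathrm{Int}}Sp(N/2,\mathbb R)$ if and only if both $\operatorname{Im}\tau\subset_{\mathrm{Int}}Sp(N/2,\mathbb C)$ and $\operatorname{Im}\tau\subset_{\mathrm{Int}}GL(N,\mathbb R)$; 3. there exist $r,s\in\mathbb N$ with $r+s=N/2$ and $\operatorname{Im}\tau\subset_{\mathrm{Int}}Sp(r,s)$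 if and only if both $\operatorname{Im}\tau\subset_{\mathrm{Int}}Sp(N/2,\mathbb C)$ and $\operatorname{Im}\tau\subset_{\mathrm{Int}}GL(N/2,\mathbb H)$; 4. $\operatorname{Im}\tau\subset_{\mathrm{Int}}O^*(2(N/2))$ if and only if both $\operatorname{Im}\tau\subset_{\mathrm{Int}}O(N,\mathbb C)$ and $\operatorname{Im}\tau\subset_{\mathrm{Int}}GL(N/2,\mathbb H)$. -/

import Mathlib

open scoped Matrix MatrixGroups Manifold ContDiff

namespace ClassicalEmbedding

/-- `S ⊂_Int T`: some `GL`-conjugate `g⁻¹ S g` of `S` is contained in `T`. -/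
def SubsetInt {ι : Type*} [Fintype ι] [DecidableEq ι] (S T : Set (GL ι ℂ)) : Prop :=
  ∃ g : GL ι ℂ, ∀ s ∈ S, g⁻¹ * s * g ∈ T

/-- The order preserving splitting of `N = p + q` indices into the first `p` and the last `q`. -/
def splitEquiv {p q N : ℕ} (h : p + q = N) : Fin p ⊕ Fin q ≃ Fin N :=
  finSumFinEquiv.trans (finCongr h)

/-- The diagonal matrix `I_{p,q}`, with `p` entries `1` followed by `q` entries `-1`. -/
def signMatrix (R : Type*) [Ring R] {p q N : ℕ} (h : p + q = N) : Matrix (Fin N) (Fin N) R :=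
  Matrix.reindex (splitEquiv h) (splitEquiv h) (Matrix.fromBlocks 1 0 0 (-1))

/-- The matrix `J_N` with blocks `0, -1, 1, 0`, for `N = 2n`. -/
def sympMatrix (R : Type*) [CommRing R] {n N : ℕ} (h : n + n = N) : Matrix (Fin N) (Fin N) R :=
  Matrix.reindex (splitEquiv h) (splitEquiv h) (Matrix.J (Fin n) R)

/-- The group of invertible matrices `g` with `ᵗg B g = B`, over a commutative ring. -/
def isometryGroup {R ι : Type*} [CommRing R] [Fintype ι] [DecidableEq ι] (B : Matrix ι ι R) :
    Subgroup (GL ι R) where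
  carrier := {g | (g : Matrix ι ι R)ᵀ * B * (g : Matrix ι ι R) = B}
  one_mem' := by simp
  mul_mem' := by
    intro a b ha hb
    simp only [Set.mem_ofPred_eq, Units.val_mul, Matrix.transpose_mul] at *
    calc _ = (b : Matrix ι ι R)ᵀ * ((a : Matrix ι ι R)ᵀ * B * (a : Matrix ι ι R)) *
          (b : Matrix ι ι R) := by simp only [Matrix.mul_assoc]
      _ = B := by rw [ha, hb]
  inv_mem' := by
    intro a ha
    simp only [Set.mem_ofPred_eq] at *
    have h1 : (a : Matrix ι ι R) * ((a⁻¹ : GL ι R) : Matrix ι ι R) = 1 := Units.mul_inv a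
    have h2 : ((a⁻¹ : GL ι R) : Matrix ι ι R)ᵀ * (a : Matrix ι ι R)ᵀ = 1 := by
      rw [← Matrix.transpose_mul, h1, Matrix.transpose_one]
    calc _ = ((a⁻¹ : GL ι R) : Matrix ι ι R)ᵀ * ((a : Matrix ι ι R)ᵀ * B * (a : Matrix ι ι R)) *
          ((a⁻¹ : GL ι R) : Matrix ι ι R) := by rw [ha]
      _ = (((a⁻¹ : GL ι R) : Matrix ι ι R)ᵀ * (a : Matrix ι ι R)ᵀ) * B *
          ((a : Matrix ι ι R) * ((a⁻¹ : GL ι R) : Matrix ι ι R)) := by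
            simp only [Matrix.mul_assoc]
      _ = B := by rw [h1, h2, Matrix.one_mul, Matrix.mul_one]

/-- The group of invertible matrices `g` with `g* B g = B`, over a possibly noncommutative
ring with involution; `g*` is the conjugate transpose. -/
def starIsometryGroup {R ι : Type*} [Ring R] [StarRing R] [Fintype ι] [DecidableEq ι]
    (B : Matrix ι ι R) : Subgroup (Matrix ι ι R)ˣ where
  carrier := {g | (g : Matrix ι ι R)ᴴ * B * (g : Matrix ι ι R) = B}
  one_mem' := by simp
  mul_mem' := by
    intro a b ha hb
    simp only [Set.mem_ofPred_eq, Units.val_mul, Matrix.conjTranspose_mul] at *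
    calc _ = (b : Matrix ι ι R)ᴴ * ((a : Matrix ι ι R)ᴴ * B * (a : Matrix ι ι R)) *
          (b : Matrix ι ι R) := by simp only [Matrix.mul_assoc]
      _ = B := by rw [ha, hb]
  inv_mem' := by
    intro a ha
    simp only [Set.mem_ofPred_eq] at *
    have h1 : (a : Matrix ι ι R) * ((a⁻¹ : (Matrix ι ι R)ˣ) : Matrix ι ι R) = 1 :=
      Units.mul_inv a
    have h2 : ((a⁻¹ : (Matrix ι ι R)ˣ) : Matrix ι ι R)ᴴ * (a : Matrix ι ι R)ᴴ = 1 := by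
      rw [← Matrix.conjTranspose_mul, h1, Matrix.conjTranspose_one]
    calc _ = ((a⁻¹ : (Matrix ι ι R)ˣ) : Matrix ι ι R)ᴴ *
          ((a : Matrix ι ι R)ᴴ * B * (a : Matrix ι ι R)) *
          ((a⁻¹ : (Matrix ι ι R)ˣ) : Matrix ι ι R) := by rw [ha]
      _ = (((a⁻¹ : (Matrix ι ι R)ˣ) : Matrix ι ι R)ᴴ * (a : Matrix ι ι R)ᴴ) * B *
          ((a : Matrix ι ι R) * ((a⁻¹ : (Matrix ι ι R)ˣ) : Matrix ι ι R)) := by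
            simp only [Matrix.mul_assoc]
      _ = B := by rw [h1, h2, Matrix.one_mul, Matrix.mul_one]

/-- The complex number `z` in the decomposition `x = z + w j` of a quaternion. -/
def quatFst (x : Quaternion ℝ) : ℂ := ⟨x.re, x.imI⟩

/-- The complex number `w` in the decomposition `x = z + w j` of a quaternion. -/
def quatSnd (x : Quaternion ℝ) : ℂ := ⟨x.imJ, x.imK⟩

theorem quatFst_one : quatFst 1 = 1 := by
  simp only [quatFst, Quaternion.re_one, Quaternion.imI_one]; rfl

theorem quatSnd_one : quatSnd 1 = 0 := by
  simp only [quatSnd, Quaternion.imJ_one, Quaternion.imK_one]; rfl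

theorem quatFst_add (x y : Quaternion ℝ) : quatFst (x + y) = quatFst x + quatFst y := by
  simp [quatFst, Complex.ext_iff]

theorem quatSnd_add (x y : Quaternion ℝ) : quatSnd (x + y) = quatSnd x + quatSnd y := by
  simp [quatSnd, Complex.ext_iff]

theorem quatFst_mul (x y : Quaternion ℝ) :
    quatFst (x * y) = quatFst x * quatFst y - quatSnd x * star (quatSnd y) := by
  simp only [quatFst, quatSnd, Complex.ext_iff, Quaternion.re_mul, Quaternion.imI_mul]
  constructor <;> simp <;> ring

theorem quatSnd_mul (x y : Quaternion ℝ) :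
    quatSnd (x * y) = quatFst x * quatSnd y + quatSnd x * star (quatFst y) := by
  simp only [quatFst, quatSnd, Complex.ext_iff, Quaternion.imJ_mul, Quaternion.imK_mul]
  constructor <;> simp <;> ring

/-- The additive map `z + w j ↦ z`. -/
def quatFstHom : Quaternion ℝ →+ ℂ := AddMonoidHom.mk' quatFst quatFst_add

/-- The additive map `z + w j ↦ w`. -/
def quatSndHom : Quaternion ℝ →+ ℂ := AddMonoidHom.mk' quatSnd quatSnd_add

theorem quatFst_zero : quatFst 0 = 0 := map_zero quatFstHom

theorem quatSnd_zero : quatSnd 0 = 0 := map_zero quatSndHom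

theorem quatFst_sum {κ : Type*} (s : Finset κ) (f : κ → Quaternion ℝ) :
    quatFst (∑ k ∈ s, f k) = ∑ k ∈ s, quatFst (f k) := map_sum quatFstHom f s

theorem quatSnd_sum {κ : Type*} (s : Finset κ) (f : κ → Quaternion ℝ) :
    quatSnd (∑ k ∈ s, f k) = ∑ k ∈ s, quatSnd (f k) := map_sum quatSndHom f s

/-- The standard embedding `Z + W j ↦ [Z, W; -W̄, Z̄]` of `M(n, ℍ)` into `M(2n, ℂ)`. -/
def quatEmbedding (n : ℕ) :
    Matrix (Fin n) (Fin n) (Quaternion ℝ) →+* Matrix (Fin n ⊕ Fin n) (Fin n ⊕ Fin n) ℂ where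
  toFun X := Matrix.fromBlocks
    (X.map quatFst) (X.map quatSnd)
    (X.map fun x => -star (quatSnd x)) (X.map fun x => star (quatFst x))
  map_one' := by
    ext i j
    rcases i with i | i <;> rcases j with j | j <;> by_cases h : i = j <;>
      simp [Matrix.one_apply, h, quatFst_one, quatSnd_one, quatFst_zero, quatSnd_zero]
  map_zero' := by
    ext i j
    rcases i with i | i <;> rcases j with j | j <;> simp [quatFst_zero, quatSnd_zero]
  map_add' X Y := by
    ext i j
    rcases i with i | i <;> rcases j with j | j <;>
      simp [quatFst_add, quatSnd_add, add_comm]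
  map_mul' X Y := by
    rw [Matrix.fromBlocks_multiply]
    ext i j
    rcases i with i | i <;> rcases j with j | j <;>
      simp only [Matrix.fromBlocks_apply₁₁, Matrix.fromBlocks_apply₁₂,
        Matrix.fromBlocks_apply₂₁, Matrix.fromBlocks_apply₂₂, Matrix.map_apply, Matrix.add_apply,
        Matrix.mul_apply, quatFst_sum, quatSnd_sum, star_sum, ← Finset.sum_add_distrib,
        ← Finset.sum_neg_distrib, quatFst_mul, quatSnd_mul] <;>
      refine Finset.sum_congr rfl fun k _ => ?_ <;>
      try simp only [star_add, star_sub, star_mul', star_star]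
    all_goals ring

/-- The inclusion `GL(N, ℝ) → GL(N, ℂ)`. -/
noncomputable def realInclusion (N : ℕ) : GL (Fin N) ℝ →* GL (Fin N) ℂ :=
  Matrix.GeneralLinearGroup.map (algebraMap ℝ ℂ)

/-- The inclusion `GL(n, ℍ) → GL(N, ℂ)` for `N = 2n`. -/
noncomputable def quatInclusion {n N : ℕ} (h : n + n = N) :
    (Matrix (Fin n) (Fin n) (Quaternion ℝ))ˣ →* GL (Fin N) ℂ :=
  Units.map (((Matrix.reindexAlgEquiv ℂ ℂ (splitEquiv h)).toRingEquiv.toRingHom.comp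
    (quatEmbedding n)).toMonoidHom)

/-- `GL(N, ℝ)` as a subgroup of `GL(N, ℂ)`. -/
noncomputable def realGL (N : ℕ) : Subgroup (GL (Fin N) ℂ) := (realInclusion N).range

/-- `GL(N/2, ℍ)` as a subgroup of `GL(N, ℂ)`. -/
noncomputable def quatGL {n N : ℕ} (h : n + n = N) : Subgroup (GL (Fin N) ℂ) := (quatInclusion h).range

/-- `O(N, ℂ)`. -/
noncomputable def complexO (N : ℕ) : Subgroup (GL (Fin N) ℂ) := isometryGroup 1

/-- `Sp(N/2, ℂ)`. -/
noncomputable def complexSp {n N : ℕ} (h : n + n = N) : Subgroup (GL (Fin N) ℂ) :=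
  isometryGroup (sympMatrix ℂ h)

/-- `O(p, q)`, `p + q = N`, as a subgroup of `GL(N, ℂ)`. -/
noncomputable def indefiniteO {p q N : ℕ} (h : p + q = N) : Subgroup (GL (Fin N) ℂ) :=
  (isometryGroup (signMatrix ℝ h)).map (realInclusion N)

/-- `Sp(N/2, ℝ)` as a subgroup of `GL(N, ℂ)`. -/
noncomputable def realSp {n N : ℕ} (h : n + n = N) : Subgroup (GL (Fin N) ℂ) :=
  (isometryGroup (sympMatrix ℝ h)).map (realInclusion N)

/-- `Sp(r, s)`, `r + s = N/2`, as a subgroup of `GL(N, ℂ)`: the quaternionic matrices preserving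
the hermitian form `I_{r,s}`. -/
noncomputable def indefiniteSp {r s n N : ℕ} (hrs : r + s = n) (h : n + n = N) : Subgroup (GL (Fin N) ℂ) :=
  (starIsometryGroup (signMatrix (Quaternion ℝ) hrs)).map (quatInclusion h)

/-- The quaternion unit `j`. -/
def quatJ : Quaternion ℝ := ⟨0, 0, 1, 0⟩

/-- `O*(2(N/2))` as a subgroup of `GL(N, ℂ)`: the quaternionic matrices preserving the
skew-hermitian form given by the scalar matrix `j`. -/
noncomputable def quatO {n N : ℕ} (h : n + n = N) : Subgroup (GL (Fin N) ℂ) :=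
  (starIsometryGroup (Matrix.diagonal fun _ : Fin n => quatJ)).map
    (quatInclusion h)

end ClassicalEmbedding

/-! Write `Φ` for the embedding `Z + W j ↦ [Z, W; -W̄, Z̄]`. A group that preserves a bilinear form
and a real or quaternionic structure also preserves a nondegenerate form defined over `ℝ` or `ℍ`;
classifying such forms identifies its isometry group with a standard one.

Real case: in coordinates where the group is real, let `C` be the matrix of the invariant bilinear
form. Real matrices preserve `Re C` and `Im C` separately, and both inherit the symmetry of `C`. The
polynomial `det (Re C + z Im C)` is nonzero at `z = i`, hence at some real `t`, so `Re C + t Im C`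
is a nondegenerate invariant real form (`SubsetInt.exists_real_form`).

Quaternionic case: `M(2n, ℂ) = Φ(M(n, ℍ)) ⊕ i Φ(M(n, ℍ))` replaces the real and imaginary parts. As
`J Φ(X)ᵀ = Φ(Xᴴ) J`, invariance of `C` becomes sesquilinear invariance of `J C`, and the same
determinant argument applies (`SubsetInt.exists_quaternion_form`). Since `J` is skew, the symmetry
flips: symmetric forms give skew-hermitian ones, and skew forms give hermitian ones.

The normal forms are `I_{p,q}` (hermitian over `ℝ` or `ℍ`), `J_N` (skew over `ℝ`) and `j` times the
identity (skew-hermitian over `ℍ`). For the other direction, a real form is extended to `ℂ`, a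
quaternionic form `M` gives the bilinear form `J Φ(M)`, and an explicit diagonal matrix makes the
result standard where needed. -/

namespace ClassicalEmbedding

/-! ### Congruence of sesquilinear forms and block elimination. -/

section StarCongruence

variable {R : Type*} [Ring R] [StarRing R]

/-- Congruence `Pᴴ M P = N` of sesquilinear forms through an invertible, possibly differently
indexed, matrix `P`. -/
def StarCongruent {ι κ : Type*} [Fintype ι] [DecidableEq ι] [Fintype κ] [DecidableEq κ]
    (M : Matrix ι ι R) (N : Matrix κ κ R) : Prop :=
  ∃ (P : Matrix ι κ R) (Q : Matrix κ ι R), P * Q = 1 ∧ Q * P = 1 ∧ Pᴴ * M * P = N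

variable {ι κ l m : Type*} [Fintype ι] [DecidableEq ι] [Fintype κ] [DecidableEq κ]
  [Fintype l] [DecidableEq l] [Fintype m] [DecidableEq m]

theorem StarCongruent.refl (M : Matrix ι ι R) : StarCongruent M M :=
  ⟨1, 1, by simp, by simp, by simp⟩

theorem StarCongruent.trans {M : Matrix ι ι R} {N : Matrix κ κ R} {K : Matrix l l R}
    (h₁ : StarCongruent M N) (h₂ : StarCongruent N K) : StarCongruent M K := by
  obtain ⟨P, Q, hPQ, hQP, rfl⟩ := h₁
  obtain ⟨P', Q', hPQ', hQP', rfl⟩ := h₂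
  refine ⟨P * P', Q' * Q, ?_, ?_, ?_⟩
  · calc _ = P * (P' * Q') * Q := by simp only [Matrix.mul_assoc]
      _ = 1 := by rw [hPQ', Matrix.mul_one, hPQ]
  · calc _ = Q' * (Q * P) * P' := by simp only [Matrix.mul_assoc]
      _ = 1 := by rw [hQP, Matrix.mul_one, hQP']
  · simp only [Matrix.conjTranspose_mul, Matrix.mul_assoc]

theorem StarCongruent.submatrix (M : Matrix ι ι R) (e : κ ≃ ι) :
    StarCongruent M (M.submatrix e e) := by
  refine ⟨(1 : Matrix ι ι R).submatrix id e, (1 : Matrix ι ι R).submatrix e id, ?_, ?_, ?_⟩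
  · rw [Matrix.submatrix_mul_equiv]; simp
  · rw [← Matrix.submatrix_mul _ _ _ _ _ Function.bijective_id]; simp
  · rw [Matrix.conjTranspose_submatrix, Matrix.conjTranspose_one]
    rw [show M = M.submatrix id id from rfl,
      ← Matrix.submatrix_mul _ _ _ _ _ Function.bijective_id,
      ← Matrix.submatrix_mul _ _ _ _ _ Function.bijective_id]
    simp

theorem StarCongruent.fromBlocks {M : Matrix ι ι R} {N : Matrix κ κ R} {M' : Matrix l l R}
    {N' : Matrix m m R} (h₁ : StarCongruent M N) (h₂ : StarCongruent M' N') :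
    StarCongruent (Matrix.fromBlocks M 0 0 M') (Matrix.fromBlocks N 0 0 N') := by
  obtain ⟨P, Q, hPQ, hQP, rfl⟩ := h₁
  obtain ⟨P', Q', hPQ', hQP', rfl⟩ := h₂
  refine ⟨Matrix.fromBlocks P 0 0 P', Matrix.fromBlocks Q 0 0 Q', ?_, ?_, ?_⟩ <;>
    simp [Matrix.fromBlocks_multiply, Matrix.fromBlocks_conjTranspose, hPQ, hQP, hPQ', hQP']

theorem StarCongruent.isUnit {M : Matrix ι ι R} {N : Matrix κ κ R}
    (h : StarCongruent M N) (hM : IsUnit M) : IsUnit N := by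
  obtain ⟨P, Q, hPQ, hQP, rfl⟩ := h
  obtain ⟨⟨M, M', h1, h2⟩, rfl⟩ := hM
  have hPQ' : Qᴴ * Pᴴ = 1 := by rw [← Matrix.conjTranspose_mul, hPQ, Matrix.conjTranspose_one]
  have hQP' : Pᴴ * Qᴴ = 1 := by rw [← Matrix.conjTranspose_mul, hQP, Matrix.conjTranspose_one]
  refine ⟨⟨_, Q * M' * Qᴴ, ?_, ?_⟩, rfl⟩
  · calc _ = Pᴴ * (M * (P * Q) * M') * Qᴴ := by simp only [Matrix.mul_assoc]
      _ = 1 := by rw [hPQ, Matrix.mul_one, h1, Matrix.mul_one, hQP']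
  · calc _ = Q * (M' * (Qᴴ * Pᴴ) * M) * P := by simp only [Matrix.mul_assoc]
      _ = 1 := by rw [hPQ', Matrix.mul_one, h2, Matrix.mul_one, hQP]

theorem StarCongruent.conjTranspose_eq {M : Matrix ι ι R} {N : Matrix κ κ R} {ε : ℤ}
    (h : StarCongruent M N) (hM : Mᴴ = ε • M) : Nᴴ = ε • N := by
  obtain ⟨P, Q, hPQ, hQP, rfl⟩ := h
  rw [Matrix.conjTranspose_mul, Matrix.conjTranspose_mul, Matrix.conjTranspose_conjTranspose, hM,
    Matrix.smul_mul, Matrix.mul_smul, Matrix.mul_assoc]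

theorem StarCongruent.exists_unit {M N : Matrix ι ι R} (h : StarCongruent M N) :
    ∃ P : (Matrix ι ι R)ˣ, (P : Matrix ι ι R)ᴴ * M * (P : Matrix ι ι R) = N := by
  obtain ⟨P, Q, hPQ, hQP, rfl⟩ := h
  exact ⟨⟨P, Q, hPQ, hQP⟩, rfl⟩

omit [StarRing R] in
theorem isUnit_of_isUnit_fromBlocks {A : Matrix ι ι R} {D : Matrix κ κ R}
    (h : IsUnit (Matrix.fromBlocks A 0 0 D)) : IsUnit D := by
  obtain ⟨⟨X, Y, h1, h2⟩, hX⟩ := h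
  obtain rfl : X = Matrix.fromBlocks A 0 0 D := hX
  rw [← Matrix.fromBlocks_toBlocks Y, Matrix.fromBlocks_multiply, ← Matrix.fromBlocks_one,
    Matrix.fromBlocks_inj] at h1 h2
  exact ⟨⟨D, Y.toBlocks₂₂, by simpa using h1.2.2.2, by simpa using h2.2.2.2⟩, rfl⟩

omit [StarRing R] in
theorem ne_zero_of_isUnit_diagonal [Nontrivial R] {d : ι → R} (h : IsUnit (Matrix.diagonal d))
    (i : ι) : d i ≠ 0 := by
  obtain ⟨⟨X, Y, h1, h2⟩, hX⟩ := h
  obtain rfl : X = Matrix.diagonal d := hX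
  intro hi
  have := congrFun (congrFun h1 i) i
  simp [hi] at this

/-- Elimination of the off-diagonal blocks of an `ε`-hermitian matrix with an invertible block. -/
theorem starCongruent_schur {ε : ℤ} (hε : ε = 1 ∨ ε = -1) {A A' : Matrix ι ι R}
    {B : Matrix ι κ R} {C : Matrix κ ι R} {D : Matrix κ κ R}
    (hM : (Matrix.fromBlocks A B C D)ᴴ = ε • Matrix.fromBlocks A B C D)
    (h1 : A * A' = 1) (h2 : A' * A = 1) :
    StarCongruent (Matrix.fromBlocks A B C D) (Matrix.fromBlocks A 0 0 (D - C * A' * B)) := by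
  rw [Matrix.fromBlocks_conjTranspose, Matrix.fromBlocks_smul, Matrix.fromBlocks_inj] at hM
  obtain ⟨hA, -, hB, -⟩ := hM
  have hA' : A'ᴴ = ε • A' := by
    have h3 : A'ᴴ * Aᴴ = 1 := by rw [← Matrix.conjTranspose_mul, h1, Matrix.conjTranspose_one]
    have h4 : A'ᴴ * A = ε • (1 : Matrix ι ι R) := by
      rcases hε with rfl | rfl
      · simpa [hA] using h3
      · rw [hA] at h3
        simp only [neg_smul, one_smul, Matrix.mul_neg] at h3 ⊢
        rw [← h3, neg_neg]
    calc A'ᴴ = A'ᴴ * A * A' := by rw [Matrix.mul_assoc, h1, Matrix.mul_one]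
      _ = ε • A' := by rw [h4]; simp
  -- Both `Bᴴ = ε C` and `A'ᴴ = ε A'` contribute a sign, and `ε² = 1`. Hence the one unipotent
  -- matrix that clears `B` also clears `C`.
  have key : (A' * B)ᴴ * A = C := by
    rw [Matrix.conjTranspose_mul, hA', hB]
    rcases hε with rfl | rfl <;> simp [Matrix.mul_assoc, h2]
  refine ⟨Matrix.fromBlocks 1 (-(A' * B)) 0 1, Matrix.fromBlocks 1 (A' * B) 0 1, ?_, ?_, ?_⟩
  · simp [Matrix.fromBlocks_multiply]
  · simp [Matrix.fromBlocks_multiply]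
  · have h5 : A * (A' * B) = B := by rw [← Matrix.mul_assoc, h1, Matrix.one_mul]
    have h6 : (A' * B)ᴴ * B = C * (A' * B) := by
      rw [← key, Matrix.mul_assoc, h5]
    rw [Matrix.fromBlocks_conjTranspose, Matrix.fromBlocks_multiply, Matrix.fromBlocks_multiply,
      Matrix.fromBlocks_inj]
    simp only [Matrix.conjTranspose_one, Matrix.conjTranspose_zero, Matrix.conjTranspose_neg,
      Matrix.one_mul, Matrix.zero_mul, Matrix.mul_one, Matrix.mul_zero, Matrix.neg_mul,
      Matrix.mul_neg, key, h5, h6, add_zero, neg_add_cancel, true_and]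
    simp [Matrix.mul_assoc, sub_eq_neg_add]

/-- Isolates a chosen index as a corner block, ready for elimination. -/
theorem exists_equiv_unit_sum {ι : Type} [DecidableEq ι] (i : ι) :
    ∃ e : Unit ⊕ {a : ι // a ≠ i} ≃ ι, e (Sum.inl ()) = i ∧ ∀ a, e (Sum.inr a) = a :=
  ⟨(Equiv.sumComm _ _).trans ((Equiv.optionEquivSumPUnit _).symm.trans (Equiv.optionSubtypeNe i)),
    by simp⟩

end StarCongruence

/-! ### Diagonalization over a division ring with involution. -/

section Diagonalization

variable {R : Type*} [DivisionRing R] [StarRing R]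

/-- If the diagonal vanishes but `M i j ≠ 0`, replacing `e_i` by `e_i + e_j x` gives the diagonal
entry `M i j * x + ε • star (M i j * x)`, and `x` is chosen so that `M i j * x = c`. The condition
on `c` rules out alternating forms, which cannot be diagonalized unless they are zero. -/
theorem exists_starCongruent_apply_ne_zero {ι : Type} [Fintype ι] [DecidableEq ι] {ε : ℤ}
    (hε : ε = 1 ∨ ε = -1) {c : R} (hc : c + ε • star c ≠ 0) {M : Matrix ι ι R}
    (hM : Mᴴ = ε • M) (h0 : M ≠ 0) :
    ∃ (N : Matrix ι ι R) (i : ι), StarCongruent M N ∧ N i i ≠ 0 := by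
  by_cases hd : ∃ i, M i i ≠ 0
  · exact ⟨M, hd.choose, .refl M, hd.choose_spec⟩
  push Not at hd
  obtain ⟨i, j, hij⟩ : ∃ i j, M i j ≠ 0 := by
    by_contra! h
    exact h0 (by ext; simp [h])
  have hne : i ≠ j := by rintro rfl; exact hij (hd i)
  set x := (M i j)⁻¹ * c with hx
  refine ⟨_, i, ⟨1 + Matrix.single j i x, 1 - Matrix.single j i x, ?_, ?_, rfl⟩, ?_⟩
  · simp [add_mul, mul_sub, hne]
  · simp [sub_mul, mul_add, hne]
  · have hji : star (M i j) = ε • M j i := congrFun (congrFun hM j) i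
    have h1 : M i j * x = c := by rw [hx, mul_inv_cancel_left₀ hij]
    have h2 : star x * M j i = ε • star c := by
      rw [← h1, star_mul (M i j) x, hji]
      rcases hε with rfl | rfl <;> simp
    have : (((1 : Matrix ι ι R) + Matrix.single j i x)ᴴ * M *
        ((1 : Matrix ι ι R) + Matrix.single j i x) : Matrix ι ι R) i i = c + ε • star c := by
      simp [add_mul, mul_add, Matrix.conjTranspose_single, hd, h1, h2, Matrix.mul_assoc,
        add_comm]
    rw [this]
    exact hc

/-- Gram–Schmidt: split off a nonzero diagonal entry and recurse on the Schur complement, which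
lives on the remaining indices and keeps the symmetry; hence the quantification over `ι`. -/
theorem exists_starCongruent_diagonal {ε : ℤ} (hε : ε = 1 ∨ ε = -1) {c : R}
    (hc : c + ε • star c ≠ 0) (n : ℕ) : ∀ (ι : Type) [Fintype ι] [DecidableEq ι],
    Fintype.card ι = n → ∀ M : Matrix ι ι R, Mᴴ = ε • M →
      ∃ d : ι → R, StarCongruent M (Matrix.diagonal d) := by
  induction n with
  | zero =>
    intro ι _ _ hι M _
    have := Fintype.card_eq_zero_iff.1 hι
    exact ⟨0, by rw [Subsingleton.elim (Matrix.diagonal 0) M]; exact .refl M⟩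
  | succ n ih =>
    intro ι _ _ hι M hM
    by_cases h0 : M = 0
    · exact ⟨0, by simpa [h0] using StarCongruent.refl (0 : Matrix ι ι R)⟩
    obtain ⟨N, i, hMN, hN⟩ := exists_starCongruent_apply_ne_zero hε hc hM h0
    obtain ⟨e, he, -⟩ := exists_equiv_unit_sum i
    have hNe := hMN.trans (StarCongruent.submatrix N e)
    set K := N.submatrix e e with hK
    have hK0 : K (Sum.inl ()) (Sum.inl ()) ≠ 0 := by simpa [hK, he] using hN
    have hKε := hNe.conjTranspose_eq hM
    clear_value K
    rw [← Matrix.fromBlocks_toBlocks K] at hNe hKε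
    have hA : K.toBlocks₁₁ = Matrix.diagonal fun _ => K (Sum.inl ()) (Sum.inl ()) := by
      ext; simp [Matrix.toBlocks₁₁]
    have hS := starCongruent_schur hε hKε
      (A' := Matrix.diagonal fun _ => (K (Sum.inl ()) (Sum.inl ()))⁻¹)
      (by rw [hA]; simp [hK0]) (by rw [hA]; simp [hK0])
    have hSε := (hNe.trans hS).conjTranspose_eq hM
    rw [Matrix.fromBlocks_conjTranspose, Matrix.fromBlocks_smul, Matrix.fromBlocks_inj] at hSε
    obtain ⟨d, hd⟩ := ih {a : ι // a ≠ i} (by simp [Fintype.card_subtype_compl, hι]) _ hSε.2.2.2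
    have := (hNe.trans hS).trans ((StarCongruent.refl _).fromBlocks hd)
    rw [hA, Matrix.fromBlocks_diagonal] at this
    have he' := StarCongruent.submatrix (Matrix.diagonal
      (Sum.elim (fun _ : Unit => K (Sum.inl ()) (Sum.inl ())) d)) e.symm
    rw [Matrix.submatrix_diagonal_equiv] at he'
    exact ⟨_, this.trans he'⟩

theorem starCongruent_diagonal_of_scaling {ι : Type} [Fintype ι] [DecidableEq ι] {d d' u : ι → R}
    (hu : ∀ i, u i ≠ 0) (h : ∀ i, star (u i) * d i * u i = d' i) :
    StarCongruent (Matrix.diagonal d) (Matrix.diagonal d') := by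
  refine ⟨Matrix.diagonal u, Matrix.diagonal fun i => (u i)⁻¹, ?_, ?_, ?_⟩
  · simp [hu]
  · simp [hu]
  · rw [Matrix.diagonal_conjTranspose, Matrix.diagonal_mul_diagonal,
      Matrix.diagonal_mul_diagonal]
    exact congrArg _ (funext h)

theorem exists_starCongruent_signMatrix {n : ℕ} {d : Fin n → R}
    (hd : ∀ i, d i = 1 ∨ d i = -1) :
    ∃ (p q : ℕ) (h : p + q = n), StarCongruent (Matrix.diagonal d) (signMatrix R h) := by
  classical
  let p := Fintype.card {i // d i = 1}
  let q := Fintype.card {i // ¬ d i = 1}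
  have h : p + q = n := by
    have := Fintype.card_congr (Equiv.sumCompl fun i => d i = 1)
    simpa [p, q] using this
  refine ⟨p, q, h, ?_⟩
  let e : Fin p ⊕ Fin q ≃ Fin n :=
    ((Fintype.equivFin {i // d i = 1}).symm.sumCongr
      (Fintype.equivFin {i // ¬ d i = 1}).symm).trans (Equiv.sumCompl fun i => d i = 1)
  have h1 := StarCongruent.submatrix (Matrix.diagonal d) e
  have h2 : (Matrix.diagonal d).submatrix e e = Matrix.fromBlocks 1 0 0 (-1) := by
    rw [Matrix.submatrix_diagonal_equiv, ← Matrix.diagonal_one, ← Matrix.diagonal_one,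
      Matrix.diagonal_neg, Matrix.fromBlocks_diagonal]
    congr 1
    ext i
    rcases i with i | i
    · simpa [e] using ((Fintype.equivFin {i // d i = 1}).symm i).2
    · simpa [e] using (hd _).resolve_left ((Fintype.equivFin {i // ¬ d i = 1}).symm i).2
  rw [h2] at h1
  exact h1.trans (StarCongruent.submatrix _ (splitEquiv h).symm)

/-- Sylvester's law of inertia (existence) for hermitian matrices. -/
theorem exists_starCongruent_signMatrix_of_isHermitian (h2 : (2 : R) ≠ 0)
    (hR : ∀ d : R, star d = d → d ≠ 0 →
      ∃ u : R, u ≠ 0 ∧ (star u * d * u = 1 ∨ star u * d * u = -1))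
    {n : ℕ} {M : Matrix (Fin n) (Fin n) R} (hM : Mᴴ = M) (hu : IsUnit M) :
    ∃ (p q : ℕ) (h : p + q = n), StarCongruent M (signMatrix R h) := by
  obtain ⟨d, hd⟩ := exists_starCongruent_diagonal (ε := 1) (Or.inl rfl) (c := (1 : R))
    (by simpa [one_add_one_eq_two] using h2) n (Fin n) (by simp) M (by simpa using hM)
  have hd0 := ne_zero_of_isUnit_diagonal (hd.isUnit hu)
  -- Congruence preserves hermitian symmetry, so each diagonal entry is self-adjoint and can be
  -- scaled to a sign.
  have hds := hd.conjTranspose_eq (ε := 1) (by simpa using hM)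
  rw [one_smul, Matrix.diagonal_conjTranspose] at hds
  have hds := Matrix.diagonal_injective hds
  choose u hu0 hu1 using fun i => hR (d i) (congrFun hds i) (hd0 i)
  obtain ⟨p, q, h, hpq⟩ := exists_starCongruent_signMatrix hu1
  exact ⟨p, q, h, (hd.trans (starCongruent_diagonal_of_scaling hu0 fun _ => rfl)).trans hpq⟩

end Diagonalization

theorem real_exists_scaling {d : ℝ} (hd : d ≠ 0) :
    ∃ u : ℝ, u ≠ 0 ∧ (u * d * u = 1 ∨ u * d * u = -1) := by
  have h : 0 < |d| := abs_pos.2 hd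
  refine ⟨(√|d|)⁻¹, by positivity, ?_⟩
  have h2 : (√|d|)⁻¹ * (√|d|)⁻¹ * |d| = 1 := by
    rw [← mul_inv, Real.mul_self_sqrt h.le, inv_mul_cancel₀ h.ne']
  rcases abs_choice d with h1 | h1
  · left; rw [h1] at h2 ⊢; linarith
  · right; rw [h1] at h2 ⊢; linarith

theorem real_exists_starCongruent_signMatrix {n : ℕ} {M : Matrix (Fin n) (Fin n) ℝ}
    (hM : Mᴴ = M) (hu : IsUnit M) :
    ∃ (p q : ℕ) (h : p + q = n), StarCongruent M (signMatrix ℝ h) :=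
  exists_starCongruent_signMatrix_of_isHermitian two_ne_zero
    (fun d _ hd => by simpa using real_exists_scaling hd) hM hu

/-- Self-adjoint quaternions are real, so the real scaling applies to each diagonal entry. -/
theorem quaternion_exists_starCongruent_signMatrix {n : ℕ}
    {M : Matrix (Fin n) (Fin n) (Quaternion ℝ)} (hM : Mᴴ = M) (hu : IsUnit M) :
    ∃ (p q : ℕ) (h : p + q = n), StarCongruent M (signMatrix (Quaternion ℝ) h) := by
  refine exists_starCongruent_signMatrix_of_isHermitian ?_ (fun d hd hd0 => ?_) hM hu
  · have h : ((2 : ℝ) : Quaternion ℝ) ≠ ((0 : ℝ) : Quaternion ℝ) :=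
      Quaternion.coe_injective.ne two_ne_zero
    exact_mod_cast h
  obtain ⟨x, rfl⟩ : ∃ x : ℝ, d = x := ⟨d.re, Quaternion.star_eq_self.1 hd⟩
  obtain ⟨u, hu, h⟩ := real_exists_scaling (d := x) (by rintro rfl; simp at hd0)
  refine ⟨u, fun h0 => hu (Quaternion.coe_injective (by simpa using h0)), ?_⟩
  rw [Quaternion.star_coe, ← Quaternion.coe_mul, ← Quaternion.coe_mul]
  rcases h with h | h
  · left; rw [h, Quaternion.coe_one]
  · right; rw [h, Quaternion.coe_neg, Quaternion.coe_one]

theorem quatJ_re : quatJ.re = 0 := rfl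

theorem quatJ_imI : quatJ.imI = 0 := rfl

theorem quatJ_imJ : quatJ.imJ = 1 := rfl

theorem quatJ_imK : quatJ.imK = 0 := rfl

/-- Purely imaginary quaternions of equal norm are conjugate, and a positive real factor adjusts the
norm. -/
theorem quaternion_exists_scaling_quatJ {d : Quaternion ℝ} (hd : star d = -d) (h0 : d ≠ 0) :
    ∃ u : Quaternion ℝ, u ≠ 0 ∧ star u * d * u = quatJ := by
  obtain ⟨v, t, ht, hv⟩ : ∃ (v : Quaternion ℝ) (t : ℝ), 0 < t ∧ star v * d * v = t • quatJ := by
    have hdd : d * d = -((‖d‖ * ‖d‖ : ℝ) : Quaternion ℝ) := by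
      rw [← Quaternion.normSq_eq_norm_mul_self, ← Quaternion.star_mul_self, hd, neg_mul, neg_neg]
    have hs : 0 < ‖d‖ := norm_pos_iff.2 h0
    have hj : quatJ * quatJ = -1 := by
      rw [← Quaternion.coe_one]
      ext <;> simp [quatJ_re, quatJ_imI, quatJ_imJ, quatJ_imK, -Quaternion.coe_one]
    -- Since `d² = -‖d‖²` and `j² = -1`, this `v` satisfies `d v = ‖d‖ v j`, so it conjugates `d` to
    -- `‖d‖ j` unless it vanishes.
    set v : Quaternion ℝ := (‖d‖ : ℝ) - d * quatJ with hv
    by_cases hv0 : v = 0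
    -- Here `d = -‖d‖ j`, and the unit `i` anticommutes with `j`.
    · refine ⟨⟨0, 1, 0, 0⟩, ‖d‖, hs, ?_⟩
      have : d = -(‖d‖ • quatJ) := by
        have h1 : d * quatJ = (‖d‖ : ℝ) := (sub_eq_zero.1 hv0).symm
        calc d = -(d * quatJ * quatJ) := by rw [mul_assoc, hj]; simp
          _ = _ := by rw [h1, Quaternion.coe_mul_eq_smul]
      generalize ‖d‖ = s at *
      obtain ⟨i, hi, h₀, h₁, h₂, h₃⟩ : ∃ i : Quaternion ℝ, i = ⟨0, 1, 0, 0⟩ ∧ i.re = 0 ∧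
        i.imI = 1 ∧ i.imJ = 0 ∧ i.imK = 0 := ⟨_, rfl, rfl, rfl, rfl, rfl⟩
      rw [this, ← hi]
      ext <;> simp [h₀, h₁, h₂, h₃, quatJ_re, quatJ_imI, quatJ_imJ, quatJ_imK]
    · refine ⟨v, ‖d‖ * (‖v‖ * ‖v‖), by positivity, ?_⟩
      have h1 : d * v = ‖d‖ • (v * quatJ) := by
        rw [hv, mul_sub, sub_mul, ← mul_assoc, hdd, mul_assoc d, hj, smul_sub,
          Quaternion.mul_coe_eq_smul, Quaternion.coe_mul_eq_smul, neg_mul,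
          Quaternion.coe_mul_eq_smul, smul_smul]
        simp
        abel
      rw [mul_assoc, h1, mul_smul_comm, ← mul_assoc, Quaternion.star_mul_self,
        Quaternion.normSq_eq_norm_mul_self, Quaternion.coe_mul_eq_smul, smul_smul]
  have hu : star ((√t)⁻¹ • v) * d * ((√t)⁻¹ • v) = quatJ := by
    rw [Quaternion.star_smul, smul_mul_assoc, smul_mul_assoc, mul_smul_comm, hv, smul_smul, smul_smul,
      ← mul_inv, Real.mul_self_sqrt ht.le, inv_mul_cancel₀ ht.ne', one_smul]
  refine ⟨_, ?_, hu⟩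
  intro h
  rw [h] at hu
  have := congrArg QuaternionAlgebra.imJ hu
  rw [mul_zero, quatJ_imJ, Quaternion.imJ_zero] at this
  exact zero_ne_one this

/-- No signature survives: every nonzero imaginary quaternion, `-j` included, scales to `j`.
Diagonalization is available because `j - star j = 2 j ≠ 0`. -/
theorem quaternion_starCongruent_quatJ {n : ℕ}
    {M : Matrix (Fin n) (Fin n) (Quaternion ℝ)} (hM : Mᴴ = -M) (hu : IsUnit M) :
    StarCongruent M (Matrix.diagonal fun _ : Fin n => quatJ) := by
  obtain ⟨d, hd⟩ := exists_starCongruent_diagonal (ε := -1) (Or.inr rfl) (c := quatJ)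
    (by
      intro h
      have := congrArg QuaternionAlgebra.imJ h
      rw [Quaternion.imJ_zero] at this
      norm_num [quatJ_imJ] at this) n (Fin n) (by simp) M (by simpa using hM)
  have hd0 := ne_zero_of_isUnit_diagonal (hd.isUnit hu)
  have hds := hd.conjTranspose_eq (ε := -1)
    (by simpa using hM)
  rw [neg_smul, one_smul, Matrix.diagonal_conjTranspose, Matrix.diagonal_neg] at hds
  have hds := Matrix.diagonal_injective hds
  choose u hu0 hu1 using fun i => quaternion_exists_scaling_quatJ (congrFun hds i) (hd0 i)
  exact hd.trans (starCongruent_diagonal_of_scaling hu0 hu1)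

/-! ### Symplectic normal form of skew forms. -/

section Skew

variable {R : Type*} [Field R] [StarRing R] [TrivialStar R] [NeZero (2 : R)]

omit [StarRing R] [TrivialStar R] in
theorem apply_self_eq_zero_of_skew {ι : Type*} {M : Matrix ι ι R}
    (hM : Mᵀ = -M) (i : ι) : M i i = 0 := by
  have h : M i i = -M i i := congrFun (congrFun hM i) i
  have h2 : (2 : R) * M i i = 0 := by rw [two_mul]; nth_rewrite 1 [h]; simp
  exact (mul_eq_zero.1 h2).resolve_left two_ne_zero

/-- Indices with `M i j = x ≠ 0` span the hyperbolic plane `[0, x; -x, 0]`. Its Schur complement is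
again skew and invertible, on two fewer indices. The index type `κ` of one half is left free; its
size is recovered afterwards. -/
theorem exists_starCongruent_J (n : ℕ) : ∀ (ι : Type) [Fintype ι] [DecidableEq ι],
    Fintype.card ι = n → ∀ M : Matrix ι ι R, Mᴴ = -M → IsUnit M →
      ∃ (κ : Type) (_ : Fintype κ) (_ : DecidableEq κ), StarCongruent M (Matrix.J κ R) := by
  induction n using Nat.strong_induction_on with
  | _ n ih =>
    intro ι _ _ hι M hM hu
    rcases isEmpty_or_nonempty ι with h | ⟨⟨i⟩⟩
    · refine ⟨Empty, inferInstance, inferInstance, 0, 0, Subsingleton.elim _ _,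
        Subsingleton.elim _ _, Subsingleton.elim _ _⟩
    obtain ⟨e, he, her⟩ := exists_equiv_unit_sum i
    obtain ⟨j, hj⟩ : ∃ j, M i j ≠ 0 := by
      by_contra! h0
      obtain ⟨⟨X, Y, h1, h2⟩, hX⟩ := hu
      obtain rfl : X = M := hX
      have := congrFun (congrFun h1 i) i
      simp [Matrix.mul_apply, h0] at this
    have hij : j ≠ i := by
      rintro rfl
      exact hj (apply_self_eq_zero_of_skew (by
        rwa [Matrix.conjTranspose_eq_transpose_of_trivial] at hM) j)
    obtain ⟨e', he', -⟩ := exists_equiv_unit_sum (⟨j, hij⟩ : {a // a ≠ i})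
    let f := (Equiv.sumAssoc _ _ _).trans (((Equiv.refl Unit).sumCongr e').trans e)
    have hMK := StarCongruent.submatrix M f
    have hKx : (M.submatrix f f) (Sum.inl (Sum.inl ())) (Sum.inl (Sum.inr ())) ≠ 0 := by
      simpa [f, he, he', her] using hj
    have hcard := Fintype.card_congr f
    rw [hι, Fintype.card_sum, Fintype.card_sum, Fintype.card_unit] at hcard
    set K := M.submatrix f f with hK
    clear_value K
    have hKs := hMK.conjTranspose_eq (ε := -1) (by simpa using hM)
    set x := K (Sum.inl (Sum.inl ())) (Sum.inl (Sum.inr ())) with hx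
    have hKt : Kᵀ = -K := by
      rwa [Matrix.conjTranspose_eq_transpose_of_trivial, neg_smul, one_smul] at hKs
    have hA : K.toBlocks₁₁ = Matrix.fromBlocks 0 (Matrix.diagonal fun _ => x)
        (-Matrix.diagonal fun _ => x) 0 := by
      ext a b
      rcases a with a | a <;> rcases b with b | b
      · simpa [Matrix.toBlocks₁₁] using apply_self_eq_zero_of_skew hKt _
      · simp [Matrix.toBlocks₁₁, hx]
      · simpa [Matrix.toBlocks₁₁] using congrFun (congrFun hKt (Sum.inl (Sum.inl ())))
          (Sum.inl (Sum.inr ()))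
      · simpa [Matrix.toBlocks₁₁] using apply_self_eq_zero_of_skew hKt _
    rw [← Matrix.fromBlocks_toBlocks K] at hMK hKs
    have hS := starCongruent_schur (Or.inr rfl) hKs
      (A' := Matrix.fromBlocks 0 (-Matrix.diagonal fun _ => x⁻¹)
        (Matrix.diagonal fun _ => x⁻¹) 0)
      (by rw [hA]; simp [Matrix.fromBlocks_multiply, hKx])
      (by rw [hA]; simp [Matrix.fromBlocks_multiply, hKx])
    have hSs := (hMK.trans hS).conjTranspose_eq (ε := -1) (by simpa using hM)
    have hSu := isUnit_of_isUnit_fromBlocks ((hMK.trans hS).isUnit hu)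
    rw [Matrix.fromBlocks_conjTranspose, Matrix.fromBlocks_smul, Matrix.fromBlocks_inj] at hSs
    obtain ⟨κ, _, _, hκ⟩ := ih _ (by omega) _ rfl _ (by simpa using hSs.2.2.2) hSu
    have hAJ : StarCongruent K.toBlocks₁₁ (Matrix.J Unit R) := by
      refine ⟨Matrix.fromBlocks 1 0 0 (-Matrix.diagonal fun _ => x⁻¹),
        Matrix.fromBlocks 1 0 0 (-Matrix.diagonal fun _ => x), ?_, ?_, ?_⟩
      · simp [Matrix.fromBlocks_multiply, hKx]
      · simp [Matrix.fromBlocks_multiply, hKx]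
      · rw [hA, Matrix.conjTranspose_eq_transpose_of_trivial, Matrix.fromBlocks_transpose,
          Matrix.fromBlocks_multiply, Matrix.fromBlocks_multiply]
        simp [hKx, Matrix.J, -Matrix.diagonal_neg]
    refine ⟨Unit ⊕ κ, inferInstance, inferInstance, ((hMK.trans hS).trans
      (hAJ.fromBlocks hκ)).trans ?_⟩
    -- Interchanging the two middle summands merges `J ⊕ J` into a single `J`.
    convert StarCongruent.submatrix _ (Equiv.sumSumSumComm Unit κ Unit κ) using 1
    ext (a | a) (b | b) <;> rcases a with a | a <;> rcases b with b | b <;>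
      simp [Matrix.J, Matrix.one_apply]

/-- In characteristic zero the traces of `P Q` and `Q P`, both identity matrices, count the two
index sets. -/
theorem StarCongruent.card_eq {R : Type*} [CommRing R] [StarRing R] [CharZero R] {ι κ : Type*}
    [Fintype ι] [DecidableEq ι] [Fintype κ] [DecidableEq κ] {M : Matrix ι ι R} {N : Matrix κ κ R}
    (h : StarCongruent M N) : Fintype.card ι = Fintype.card κ := by
  obtain ⟨P, Q, hPQ, hQP, -⟩ := h
  have := Matrix.trace_mul_comm P Q
  rw [hPQ, hQP, Matrix.trace_one, Matrix.trace_one] at this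
  exact_mod_cast this

theorem starCongruent_sympMatrix [CharZero R] {n N : ℕ} (h : n + n = N)
    {M : Matrix (Fin N) (Fin N) R} (hM : Mᴴ = -M) (hu : IsUnit M) :
    StarCongruent M (sympMatrix R h) := by
  obtain ⟨κ, _, _, hκ⟩ := exists_starCongruent_J N (Fin N) (by simp) M hM hu
  have hc := hκ.card_eq
  rw [Fintype.card_sum, Fintype.card_fin] at hc
  let e : Fin n ≃ κ := Fintype.equivOfCardEq (by rw [Fintype.card_fin]; omega)
  have h1 := StarCongruent.submatrix (Matrix.J κ R) (e.sumCongr e)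
  have h2 : (Matrix.J κ R).submatrix (e.sumCongr e) (e.sumCongr e) = Matrix.J (Fin n) R := by
    ext (a | a) (b | b) <;> simp [Matrix.J, Matrix.one_apply]
  rw [h2] at h1
  exact (hκ.trans h1).trans (StarCongruent.submatrix _ (splitEquiv h).symm)

end Skew

/-! ### Change of basis for isometry groups, and a nondegenerate real combination. -/

section SubsetInt

variable {ι : Type*} [Fintype ι] [DecidableEq ι]

theorem SubsetInt.conj {S T T' : Set (GL ι ℂ)} (h : SubsetInt S T) (P : GL ι ℂ)
    (hT : ∀ t ∈ T, P⁻¹ * t * P ∈ T') : SubsetInt S T' := by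
  obtain ⟨g, hg⟩ := h
  refine ⟨g * P, fun s hs => ?_⟩
  have := hT _ (hg s hs)
  rwa [show P⁻¹ * (g⁻¹ * s * g) * P = (g * P)⁻¹ * s * (g * P) by group] at this

theorem SubsetInt.mono {S T T' : Set (GL ι ℂ)} (h : SubsetInt S T) (hT : T ⊆ T') :
    SubsetInt S T' := by
  obtain ⟨g, hg⟩ := h
  exact ⟨g, fun s hs => hT (hg s hs)⟩

theorem mem_isometryGroup {R : Type*} [CommRing R] {B : Matrix ι ι R} {g : GL ι R} :
    g ∈ isometryGroup B ↔ (g : Matrix ι ι R)ᵀ * B * (g : Matrix ι ι R) = B := Iff.rfl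

theorem mem_starIsometryGroup {R : Type*} [Ring R] [StarRing R] {B : Matrix ι ι R}
    {g : (Matrix ι ι R)ˣ} :
    g ∈ starIsometryGroup B ↔ (g : Matrix ι ι R)ᴴ * B * (g : Matrix ι ι R) = B := Iff.rfl

theorem isometryGroup_conj {R : Type*} [CommRing R] {B : Matrix ι ι R} {g : GL ι R} (P : GL ι R)
    (hg : g ∈ isometryGroup B) :
    P⁻¹ * g * P ∈ isometryGroup ((P : Matrix ι ι R)ᵀ * B * (P : Matrix ι ι R)) := by
  rw [mem_isometryGroup] at *
  have h : (g : Matrix ι ι R) * P = P * ((P⁻¹ * g * P : GL ι R) : Matrix ι ι R) := by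
    rw [← Units.val_mul, ← Units.val_mul]
    group
  calc _ = ((P : Matrix ι ι R) * ((P⁻¹ * g * P : GL ι R) : Matrix ι ι R))ᵀ * B *
        (P * ((P⁻¹ * g * P : GL ι R) : Matrix ι ι R)) := by
          simp only [Matrix.transpose_mul, Matrix.mul_assoc]
    _ = (P : Matrix ι ι R)ᵀ * ((g : Matrix ι ι R)ᵀ * B * g) * P := by
          rw [← h]; simp only [Matrix.transpose_mul, Matrix.mul_assoc]
    _ = _ := by rw [hg]

theorem starIsometryGroup_conj {R : Type*} [Ring R] [StarRing R] {B : Matrix ι ι R}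
    {g : (Matrix ι ι R)ˣ} (P : (Matrix ι ι R)ˣ) (hg : g ∈ starIsometryGroup B) :
    P⁻¹ * g * P ∈ starIsometryGroup ((P : Matrix ι ι R)ᴴ * B * (P : Matrix ι ι R)) := by
  rw [mem_starIsometryGroup] at *
  have h : (g : Matrix ι ι R) * P = P * ((P⁻¹ * g * P : (Matrix ι ι R)ˣ) : Matrix ι ι R) := by
    rw [← Units.val_mul, ← Units.val_mul]
    group
  calc _ = ((P : Matrix ι ι R) * ((P⁻¹ * g * P : (Matrix ι ι R)ˣ) : Matrix ι ι R))ᴴ * B *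
        (P * ((P⁻¹ * g * P : (Matrix ι ι R)ˣ) : Matrix ι ι R)) := by
          simp only [Matrix.conjTranspose_mul, Matrix.mul_assoc]
    _ = (P : Matrix ι ι R)ᴴ * ((g : Matrix ι ι R)ᴴ * B * g) * P := by
          rw [← h]; simp only [Matrix.conjTranspose_mul, Matrix.mul_assoc]
    _ = _ := by rw [hg]

/-- The polynomial `det (A + z B)` is nonzero at `z = i`, so it cannot vanish on the infinite set
`ℝ`. -/
theorem exists_isUnit_add_real_smul {A B : Matrix ι ι ℂ} (h : IsUnit (A + Complex.I • B)) :
    ∃ t : ℝ, IsUnit (A + (t : ℂ) • B) := by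
  let p : Polynomial ℂ := (A.map Polynomial.C + (Polynomial.X : Polynomial ℂ) •
    B.map Polynomial.C).det
  have hp : ∀ z : ℂ, p.eval z = (A + z • B).det := by
    intro z
    rw [← Polynomial.coe_evalRingHom, RingHom.map_det]
    congr 1
    ext i j
    simp [mul_comm z]
  by_contra! h0
  have h1 : p = 0 := by
    refine Polynomial.eq_zero_of_infinite_isRoot p
      (Set.Infinite.mono ?_ (Set.infinite_range_of_injective Complex.ofReal_injective))
    rintro _ ⟨t, rfl⟩
    have := h0 t
    rw [Matrix.isUnit_iff_isUnit_det, isUnit_iff_ne_zero, not_not] at this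
    exact (hp t).trans this
  have := hp Complex.I
  rw [h1, Polynomial.eval_zero] at this
  rw [Matrix.isUnit_iff_isUnit_det, ← this] at h
  exact not_isUnit_zero h

end SubsetInt

/-! ### Real structures: `O(p, q)` and `Sp(N/2, ℝ)`. -/

section Real

variable {N : ℕ} {S : Set (GL (Fin N) ℂ)}

theorem coe_realInclusion (X : GL (Fin N) ℝ) :
    (realInclusion N X : Matrix (Fin N) (Fin N) ℂ) =
      (X : Matrix (Fin N) (Fin N) ℝ).map Complex.ofRealHom := rfl

theorem map_re_add_I_smul_map_im {ι κ : Type*} (B : Matrix ι κ ℂ) :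
    (B.map Complex.re).map Complex.ofRealHom +
      Complex.I • (B.map Complex.im).map Complex.ofRealHom = B := by
  ext i j
  simp [mul_comm Complex.I, Complex.re_add_im]

theorem isUnit_of_isUnit_map_ofReal {ι : Type*} [Fintype ι] [DecidableEq ι] {M : Matrix ι ι ℝ}
    (h : IsUnit (M.map Complex.ofRealHom)) : IsUnit M := by
  rw [Matrix.isUnit_iff_isUnit_det, isUnit_iff_ne_zero] at *
  rintro h0
  apply h
  rw [← RingHom.mapMatrix_apply, ← RingHom.map_det, h0, map_zero]

theorem map_ofReal_mul_mul {ι : Type*} [Fintype ι] (X Y : Matrix ι ι ℝ) (B : Matrix ι ι ℂ) :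
    (X.map Complex.ofRealHom * B * Y.map Complex.ofRealHom).map Complex.re =
        X * B.map Complex.re * Y ∧
      (X.map Complex.ofRealHom * B * Y.map Complex.ofRealHom).map Complex.im =
        X * B.map Complex.im * Y := by
  constructor <;> ext i j <;> simp [Matrix.mul_apply, Finset.sum_mul]

/-- A subset preserving both a bilinear form and a real structure preserves a real form of the
same symmetry. -/
theorem SubsetInt.exists_real_form {B : Matrix (Fin N) (Fin N) ℂ} {ε : ℤ} (hB : Bᵀ = ε • B)
    (hu : IsUnit B) (h₁ : SubsetInt S (isometryGroup B)) (h₂ : SubsetInt S (realGL N)) :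
    ∃ M : Matrix (Fin N) (Fin N) ℝ, Mᴴ = ε • M ∧ IsUnit M ∧
      SubsetInt S ((isometryGroup M).map (realInclusion N)) := by
  obtain ⟨b, hb⟩ := h₁
  obtain ⟨a, ha⟩ := h₂
  -- `C` below is the invariant form rewritten in the coordinates given by `a`, where the set
  -- consists of real matrices.
  set c : GL (Fin N) ℂ := b⁻¹ * a with hc
  set C : Matrix (Fin N) (Fin N) ℂ := (c : Matrix (Fin N) (Fin N) ℂ)ᵀ * B * c with hC
  have hCu : IsUnit C := by
    refine (IsUnit.mul ?_ hu).mul c.isUnit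
    rw [Matrix.isUnit_transpose]
    exact c.isUnit
  have hCt : Cᵀ = ε • C := by
    rw [hC, Matrix.transpose_mul, Matrix.transpose_mul, Matrix.transpose_transpose, hB,
      Matrix.smul_mul, Matrix.mul_smul, Matrix.mul_assoc]
  obtain ⟨t, ht⟩ := exists_isUnit_add_real_smul (A := (C.map Complex.re).map Complex.ofRealHom)
    (B := (C.map Complex.im).map Complex.ofRealHom) (by rwa [map_re_add_I_smul_map_im])
  refine ⟨C.map Complex.re + t • C.map Complex.im, ?_, ?_, a, fun s hs => ?_⟩
  · rw [Matrix.conjTranspose_eq_transpose_of_trivial]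
    ext i j
    have := congrFun (congrFun hCt i) j
    simp only [Matrix.transpose_apply, Matrix.smul_apply] at this
    simp [this]
    ring
  · refine isUnit_of_isUnit_map_ofReal ?_
    convert ht
    ext i j
    simp
  · obtain ⟨X, hX⟩ := ha s hs
    refine ⟨X, ?_, hX⟩
    have h3 := isometryGroup_conj c (hb s hs)
    rw [show c⁻¹ * (b⁻¹ * s * b) * c = a⁻¹ * s * a by rw [hc]; group, ← hX, mem_isometryGroup,
      coe_realInclusion, ← hC, ← Matrix.transpose_map] at h3
    -- As `X` is real, `Xᵀ C X = C` splits into its real and imaginary parts.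
    obtain ⟨h4, h5⟩ := map_ofReal_mul_mul (X : Matrix (Fin N) (Fin N) ℝ)ᵀ X C
    rw [h3] at h4 h5
    change (X : Matrix (Fin N) (Fin N) ℝ)ᵀ * _ * (X : Matrix (Fin N) (Fin N) ℝ) = _
    rw [Matrix.mul_add, Matrix.add_mul, Matrix.mul_smul, Matrix.smul_mul, ← h4, ← h5]

theorem SubsetInt.of_starCongruent_real {M M' : Matrix (Fin N) (Fin N) ℝ}
    (h : SubsetInt S ((isometryGroup M).map (realInclusion N))) (hM : StarCongruent M M') :
    SubsetInt S ((isometryGroup M').map (realInclusion N)) := by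
  obtain ⟨P, rfl⟩ := hM.exists_unit
  refine h.conj (realInclusion N P) ?_
  rintro _ ⟨X, hX, rfl⟩
  refine ⟨P⁻¹ * X * P, ?_, by simp⟩
  rw [Matrix.conjTranspose_eq_transpose_of_trivial]
  exact isometryGroup_conj P hX

theorem map_isometryGroup_le {M : Matrix (Fin N) (Fin N) ℝ} :
    (isometryGroup M).map (realInclusion N) ≤ isometryGroup (M.map Complex.ofRealHom) := by
  rintro _ ⟨X, hX, rfl⟩
  rw [mem_isometryGroup, coe_realInclusion, ← Matrix.transpose_map, ← Matrix.map_mul,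
    ← Matrix.map_mul, mem_isometryGroup.1 hX]

theorem map_subset_realGL (H : Subgroup (GL (Fin N) ℝ)) :
    (H.map (realInclusion N) : Set (GL (Fin N) ℂ)) ⊆ realGL N := by
  rintro _ ⟨X, _, rfl⟩
  exact ⟨X, rfl⟩

theorem sympMatrix_transpose {R : Type*} [CommRing R] {n : ℕ} (h : n + n = N) :
    (sympMatrix R h)ᵀ = -sympMatrix R h := by
  rw [sympMatrix, Matrix.transpose_reindex, Matrix.J_transpose]
  rfl

theorem isUnit_sympMatrix {R : Type*} [CommRing R] {n : ℕ} (h : n + n = N) :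
    IsUnit (sympMatrix R h) := by
  rw [Matrix.isUnit_iff_isUnit_det, sympMatrix, Matrix.det_reindex_self]
  exact Matrix.isUnit_det_J _ _

theorem subsetInt_indefiniteO_iff :
    (∃ (p q : ℕ) (h : p + q = N), SubsetInt S (indefiniteO h)) ↔
      SubsetInt S (complexO N) ∧ SubsetInt S (realGL N) := by
  constructor
  · rintro ⟨p, q, h, hS⟩
    refine ⟨?_, hS.mono (map_subset_realGL _)⟩
    -- With `D z = diag (I_p, z I_q)`, the sign matrix is `D (-1)` and `D(i)ᵀ D(-1) D(i) = 1`.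
    let D (z : ℂ) : Matrix (Fin N) (Fin N) ℂ :=
      Matrix.reindexAlgEquiv ℂ ℂ (splitEquiv h) 
        (Matrix.fromBlocks 1 0 0 (Matrix.diagonal fun _ => z))
    have hD (z w : ℂ) : D z * D w = D (z * w) := by
      rw [← map_mul, Matrix.fromBlocks_multiply]
      simp [D]
    have hD1 : D 1 = 1 := by simp [D]
    have hDt (z : ℂ) : (D z)ᵀ = D z := by
      simp [D, Matrix.fromBlocks_transpose]
    have hs : (signMatrix ℝ h).map Complex.ofRealHom = D (-1) := by
      rw [signMatrix, Matrix.reindex_apply, ← Matrix.submatrix_map, Matrix.fromBlocks_map]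
      simp [D, Matrix.map_neg, ← Matrix.diagonal_neg]
    refine hS.conj ⟨D Complex.I, D (-Complex.I), by simp [hD, hD1], by simp [hD, hD1]⟩
      fun t ht => ?_
    have := isometryGroup_conj ⟨D Complex.I, D (-Complex.I), by simp [hD, hD1],
      by simp [hD, hD1]⟩ (map_isometryGroup_le ht)
    simpa [hs, hDt, hD, hD1, complexO] using this
  · rintro ⟨h₁, h₂⟩
    obtain ⟨M, hM, hu, hS⟩ := h₁.exists_real_form (ε := 1) (by simp) isUnit_one h₂
    obtain ⟨p, q, h, hc⟩ := real_exists_starCongruent_signMatrix (by simpa using hM) hu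
    exact ⟨p, q, h, hS.of_starCongruent_real hc⟩

theorem subsetInt_realSp_iff {n : ℕ} (hN : n + n = N) :
    SubsetInt S (realSp hN) ↔ SubsetInt S (complexSp hN) ∧ SubsetInt S (realGL N) := by
  constructor
  · intro hS
    refine ⟨hS.mono fun t ht => ?_, hS.mono (map_subset_realGL _)⟩
    have hJ : (sympMatrix ℝ hN).map Complex.ofRealHom = sympMatrix ℂ hN := by
      rw [sympMatrix, sympMatrix, ← Matrix.map_J (l := Fin n) Complex.ofRealHom]
      rfl
    have := map_isometryGroup_le ht
    rwa [hJ] at this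
  · rintro ⟨h₁, h₂⟩
    obtain ⟨M, hM, hu, hS⟩ := h₁.exists_real_form (ε := -1)
      (by simpa using sympMatrix_transpose hN) (isUnit_sympMatrix hN) h₂
    exact hS.of_starCongruent_real (starCongruent_sympMatrix hN (by simpa using hM) hu)

end Real

/-! ### `M(2n, ℂ)` as the complexification of `M(n, ℍ)`. -/

section QuaternionEmbedding

variable {n : ℕ}

theorem quatEmbedding_apply (X : Matrix (Fin n) (Fin n) (Quaternion ℝ)) :
    quatEmbedding n X = Matrix.fromBlocks (X.map quatFst) (X.map quatSnd)
      (X.map fun x => -star (quatSnd x)) (X.map fun x => star (quatFst x)) := rfl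

theorem quatFst_star (x : Quaternion ℝ) : quatFst (star x) = star (quatFst x) := by
  simp [quatFst, Complex.ext_iff]

theorem quatSnd_star (x : Quaternion ℝ) : quatSnd (star x) = -quatSnd x := by
  simp [quatSnd, Complex.ext_iff]

theorem quatFst_smul (t : ℝ) (x : Quaternion ℝ) : quatFst (t • x) = t * quatFst x := by
  simp [quatFst, Complex.ext_iff]

theorem quatSnd_smul (t : ℝ) (x : Quaternion ℝ) : quatSnd (t • x) = t * quatSnd x := by
  simp [quatSnd, Complex.ext_iff]

theorem quat_ext {x y : Quaternion ℝ} (h₁ : quatFst x = quatFst y) (h₂ : quatSnd x = quatSnd y) :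
    x = y := by
  rw [Complex.ext_iff] at h₁ h₂
  exact Quaternion.ext (a := x) (b := y) h₁.1 h₁.2 h₂.1 h₂.2

theorem quatEmbedding_smul (t : ℝ) (X : Matrix (Fin n) (Fin n) (Quaternion ℝ)) :
    quatEmbedding n (t • X) = (t : ℂ) • quatEmbedding n X := by
  ext (i | i) (j | j) <;> simp [quatEmbedding_apply, quatFst_smul, quatSnd_smul]

/-- The bridge between complex bilinear and quaternionic sesquilinear forms: `J` intertwines the
complex transpose with the quaternionic adjoint. -/
theorem quatEmbedding_transpose_mul_J (X : Matrix (Fin n) (Fin n) (Quaternion ℝ)) :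
    (quatEmbedding n X)ᵀ * Matrix.J (Fin n) ℂ = Matrix.J (Fin n) ℂ * quatEmbedding n Xᴴ := by
  rw [quatEmbedding_apply, quatEmbedding_apply, Matrix.fromBlocks_transpose, Matrix.J,
    Matrix.fromBlocks_multiply, Matrix.fromBlocks_multiply, Matrix.fromBlocks_inj]
  refine ⟨?_, ?_, ?_, ?_⟩ <;> ext i j <;> simp [quatFst_star, quatSnd_star]

theorem J_mul_quatEmbedding_transpose (X : Matrix (Fin n) (Fin n) (Quaternion ℝ)) :
    Matrix.J (Fin n) ℂ * (quatEmbedding n X)ᵀ = quatEmbedding n Xᴴ * Matrix.J (Fin n) ℂ := by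
  rw [quatEmbedding_apply, quatEmbedding_apply, Matrix.fromBlocks_transpose, Matrix.J,
    Matrix.fromBlocks_multiply, Matrix.fromBlocks_multiply, Matrix.fromBlocks_inj]
  refine ⟨?_, ?_, ?_, ?_⟩ <;> ext i j <;> simp [quatFst_star, quatSnd_star]

/-- The quaternionic part `A` of a complex matrix `A + i B`, with `A` and `B` in the image of
`quatEmbedding`. -/
noncomputable def quatPart (K : Matrix (Fin n ⊕ Fin n) (Fin n ⊕ Fin n) ℂ) :
    Matrix (Fin n) (Fin n) (Quaternion ℝ) :=
  Matrix.of fun i j =>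
    let z := (K (.inl i) (.inl j) + star (K (.inr i) (.inr j))) / 2
    let w := (K (.inl i) (.inr j) - star (K (.inr i) (.inl j))) / 2
    ⟨z.re, z.im, w.re, w.im⟩

theorem quatFst_quatPart (K : Matrix (Fin n ⊕ Fin n) (Fin n ⊕ Fin n) ℂ) (i j : Fin n) :
    quatFst (quatPart K i j) = (K (.inl i) (.inl j) + star (K (.inr i) (.inr j))) / 2 := rfl

theorem quatSnd_quatPart (K : Matrix (Fin n ⊕ Fin n) (Fin n ⊕ Fin n) ℂ) (i j : Fin n) :
    quatSnd (quatPart K i j) = (K (.inl i) (.inr j) - star (K (.inr i) (.inl j))) / 2 := rfl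

/-- The analogue of `C = Re C + i Im C`; the quaternionic part of `-i K` plays the role of the
imaginary part. -/
theorem quatEmbedding_quatPart_add (K : Matrix (Fin n ⊕ Fin n) (Fin n ⊕ Fin n) ℂ) :
    quatEmbedding n (quatPart K) +
      Complex.I • quatEmbedding n (quatPart (-Complex.I • K)) = K := by
  have hI (z : ℂ) : Complex.I * (Complex.I * z) = -z := by
    rw [← mul_assoc, Complex.I_mul_I, neg_one_mul]
  ext (i | i) (j | j) <;>
    simp only [Matrix.add_apply, Matrix.smul_apply, quatEmbedding_apply,
      Matrix.fromBlocks_apply₁₁, Matrix.fromBlocks_apply₁₂, Matrix.fromBlocks_apply₂₁,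
      Matrix.fromBlocks_apply₂₂, Matrix.map_apply, quatFst_quatPart, quatSnd_quatPart,
      smul_eq_mul, Complex.star_def, map_div₀, map_add, map_sub, map_mul, map_neg,
      Complex.conj_I, Complex.conj_conj, map_ofNat] <;>
    ring_nf <;> simp <;> ring

theorem quatPart_quatEmbedding_add (X Y : Matrix (Fin n) (Fin n) (Quaternion ℝ)) :
    quatPart (quatEmbedding n X + Complex.I • quatEmbedding n Y) = X := by
  ext1 i j
  refine quat_ext ?_ ?_
  · rw [quatFst_quatPart]
    simp [quatEmbedding_apply]
    ring
  · rw [quatSnd_quatPart]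
    simp [quatEmbedding_apply]

theorem quatPart_quatEmbedding (X : Matrix (Fin n) (Fin n) (Quaternion ℝ)) :
    quatPart (quatEmbedding n X) = X := by
  simpa using quatPart_quatEmbedding_add X 0

theorem quatPart_mul_mul (X Y : Matrix (Fin n) (Fin n) (Quaternion ℝ))
    (K : Matrix (Fin n ⊕ Fin n) (Fin n ⊕ Fin n) ℂ) :
    quatPart (quatEmbedding n X * K * quatEmbedding n Y) = X * quatPart K * Y := by
  nth_rewrite 1 [← quatEmbedding_quatPart_add K]
  rw [Matrix.mul_add, Matrix.add_mul, Matrix.mul_smul, Matrix.smul_mul, ← map_mul, ← map_mul,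
    ← map_mul, ← map_mul, quatPart_quatEmbedding_add]

/-- `quatPart` is linear over `M(n, ℍ)` on both sides, so it sends the complex inverse to a
quaternionic one. -/
theorem isUnit_of_isUnit_quatEmbedding {X : Matrix (Fin n) (Fin n) (Quaternion ℝ)}
    (h : IsUnit (quatEmbedding n X)) : IsUnit X := by
  obtain ⟨⟨Z, Y, h1, h2⟩, hZ⟩ := h
  obtain rfl : Z = quatEmbedding n X := hZ
  have h3 := quatPart_mul_mul X 1 Y
  have h4 := quatPart_mul_mul 1 X Y
  have h5 : quatPart (n := n) 1 = 1 := by simpa using quatPart_quatEmbedding (n := n) 1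
  rw [map_one, mul_one, mul_one, h1, h5] at h3
  rw [map_one, one_mul, one_mul, h2, h5] at h4
  exact ⟨⟨X, quatPart Y, h3.symm, h4.symm⟩, rfl⟩

/-- The quaternionic adjoint extends complex-linearly to `K ↦ J Kᵀ J⁻¹`, which sends `J C` to `J Cᵀ
Jᵀ J⁻¹ = -J Cᵀ`. The extra sign comes from `Jᵀ = -J`. -/
theorem quatPart_J_mul_conjTranspose {C : Matrix (Fin n ⊕ Fin n) (Fin n ⊕ Fin n) ℂ} {ε : ℤ}
    (hC : Cᵀ = ε • C) :
    (quatPart (Matrix.J (Fin n) ℂ * C))ᴴ = -ε • quatPart (Matrix.J (Fin n) ℂ * C) := by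
  have h (a b) : C a b = ε * C b a := by
    have := congrFun (congrFun hC b) a
    simpa using this
  have hJ : Matrix.J (Fin n) ℂ * C =
      Matrix.fromBlocks (-C.toBlocks₂₁) (-C.toBlocks₂₂) C.toBlocks₁₁ C.toBlocks₁₂ := by
    nth_rewrite 1 [← Matrix.fromBlocks_toBlocks C]
    simp [Matrix.J, Matrix.fromBlocks_multiply]
  have hz (m : ℤ) (x : Quaternion ℝ) : m • x = (m : ℝ) • x := (Int.cast_smul_eq_zsmul ℝ m x).symm
  rw [hJ]
  ext1 i j
  rw [Matrix.conjTranspose_apply, Matrix.smul_apply, hz]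
  refine quat_ext ?_ ?_
  · rw [quatFst_star, quatFst_smul, quatFst_quatPart, quatFst_quatPart]
    simp [Matrix.toBlocks₂₁, Matrix.toBlocks₁₂]
    rw [h (.inr j) (.inl i), h (.inl j)]
    simp
    ring
  · rw [quatSnd_star, quatSnd_smul, quatSnd_quatPart, quatSnd_quatPart]
    simp [Matrix.toBlocks₂₂, Matrix.toBlocks₁₁]
    rw [h (.inr j), h (.inl j)]
    simp
    ring

theorem quatEmbedding_diagonal_quatJ :
    quatEmbedding n (Matrix.diagonal fun _ => quatJ) = Matrix.fromBlocks 0 1 (-1) 0 := by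
  have h₁ : quatFst quatJ = 0 := rfl
  have h₂ : quatSnd quatJ = 1 := rfl
  rw [quatEmbedding_apply, Matrix.fromBlocks_inj]
  refine ⟨?_, ?_, ?_, ?_⟩ <;> ext i j <;> by_cases h : i = j <;>
    simp [Matrix.one_apply, h, h₁, h₂, quatFst_zero, quatSnd_zero]

theorem quatEmbedding_signMatrix {r s : ℕ} (h : r + s = n) :
    quatEmbedding n (signMatrix (Quaternion ℝ) h) =
      Matrix.fromBlocks (signMatrix ℂ h) 0 0 (signMatrix ℂ h) := by
  have h₁ : quatFst (-1) = -1 := by rw [← quatFst_one]; exact map_neg quatFstHom 1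
  have h₂ : quatSnd (-1) = 0 := by rw [← neg_zero, ← quatSnd_one]; exact map_neg quatSndHom 1
  have h₃ (i j : Fin n) : signMatrix (Quaternion ℝ) h i j = 0 ∧ signMatrix ℂ h i j = 0 ∨
      signMatrix (Quaternion ℝ) h i j = 1 ∧ signMatrix ℂ h i j = 1 ∨
      signMatrix (Quaternion ℝ) h i j = -1 ∧ signMatrix ℂ h i j = -1 := by
    obtain ⟨i, rfl⟩ := (splitEquiv h).surjective i
    obtain ⟨j, rfl⟩ := (splitEquiv h).surjective j
    rcases i with i | i <;> rcases j with j | j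
    · by_cases hij : i = j <;> simp [signMatrix, hij]
    · simp [signMatrix]
    · simp [signMatrix]
    · by_cases hij : i = j <;> simp [signMatrix, hij]
  rw [quatEmbedding_apply, Matrix.fromBlocks_inj]
  refine ⟨?_, ?_, ?_, ?_⟩ <;> ext1 i j <;>
    rcases h₃ i j with ⟨h₄, h₅⟩ | ⟨h₄, h₅⟩ | ⟨h₄, h₅⟩ <;>
    simp [h₄, h₅, h₁, h₂, quatFst_zero, quatSnd_zero, quatFst_one, quatSnd_one]

end QuaternionEmbedding

/-! ### Quaternionic structures: `Sp(r, s)` and `O*(2(N/2))`. -/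

section Quaternion

variable {n N : ℕ} (hN : n + n = N) {S : Set (GL (Fin N) ℂ)}

theorem coe_quatInclusion (X : (Matrix (Fin n) (Fin n) (Quaternion ℝ))ˣ) :
    (quatInclusion hN X : Matrix (Fin N) (Fin N) ℂ) =
      (quatEmbedding n X).submatrix (splitEquiv hN).symm (splitEquiv hN).symm := rfl

theorem map_subset_quatGL (H : Subgroup (Matrix (Fin n) (Fin n) (Quaternion ℝ))ˣ) :
    (H.map (quatInclusion hN) : Set (GL (Fin N) ℂ)) ⊆ quatGL hN := by
  rintro _ ⟨X, _, rfl⟩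
  exact ⟨X, rfl⟩

theorem SubsetInt.of_starCongruent_quaternion {M M' : Matrix (Fin n) (Fin n) (Quaternion ℝ)}
    (h : SubsetInt S ((starIsometryGroup M).map (quatInclusion hN))) (hM : StarCongruent M M') :
    SubsetInt S ((starIsometryGroup M').map (quatInclusion hN)) := by
  obtain ⟨P, rfl⟩ := hM.exists_unit
  refine h.conj (quatInclusion hN P) ?_
  rintro _ ⟨X, hX, rfl⟩
  exact ⟨P⁻¹ * X * P, starIsometryGroup_conj P hX, by simp⟩

theorem map_starIsometryGroup_le {M : Matrix (Fin n) (Fin n) (Quaternion ℝ)} :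
    (starIsometryGroup M).map (quatInclusion hN) ≤ isometryGroup
      ((Matrix.J (Fin n) ℂ * quatEmbedding n M).submatrix (splitEquiv hN).symm
        (splitEquiv hN).symm) := by
  rintro _ ⟨X, hX, rfl⟩
  rw [mem_isometryGroup, coe_quatInclusion, Matrix.transpose_submatrix,
    Matrix.submatrix_mul_equiv, Matrix.submatrix_mul_equiv, ← Matrix.mul_assoc,
    quatEmbedding_transpose_mul_J, Matrix.mul_assoc, Matrix.mul_assoc, ← map_mul, ← map_mul,
    ← Matrix.mul_assoc, mem_starIsometryGroup.1 hX]

/-- A subset preserving both a bilinear form and a quaternionic structure preserves a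
quaternionic sesquilinear form of the opposite symmetry. -/
theorem SubsetInt.exists_quaternion_form {B : Matrix (Fin N) (Fin N) ℂ} {ε : ℤ}
    (hB : Bᵀ = ε • B) (hu : IsUnit B) (h₁ : SubsetInt S (isometryGroup B))
    (h₂ : SubsetInt S (quatGL hN)) :
    ∃ M : Matrix (Fin n) (Fin n) (Quaternion ℝ), Mᴴ = -ε • M ∧ IsUnit M ∧
      SubsetInt S ((starIsometryGroup M).map (quatInclusion hN)) := by
  obtain ⟨b, hb⟩ := h₁
  obtain ⟨a, ha⟩ := h₂
  set c : GL (Fin N) ℂ := b⁻¹ * a with hc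
  set B' : Matrix (Fin N) (Fin N) ℂ := (c : Matrix (Fin N) (Fin N) ℂ)ᵀ * B * c with hB'
  have hBu : IsUnit B' := by
    refine (IsUnit.mul ?_ hu).mul c.isUnit
    rw [Matrix.isUnit_transpose]
    exact c.isUnit
  have hBt : B'ᵀ = ε • B' := by
    rw [hB', Matrix.transpose_mul, Matrix.transpose_mul, Matrix.transpose_transpose, hB,
      Matrix.smul_mul, Matrix.mul_smul, Matrix.mul_assoc]
  set C := B'.submatrix (splitEquiv hN) (splitEquiv hN) with hC
  have hCB : C.submatrix (splitEquiv hN).symm (splitEquiv hN).symm = B' := by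
    ext; simp [hC]
  have hCt : Cᵀ = ε • C := by rw [hC, Matrix.transpose_submatrix, hBt]; rfl
  set K := Matrix.J (Fin n) ℂ * C with hK
  have hKu : IsUnit K := by
    rw [Matrix.isUnit_iff_isUnit_det] at *
    rw [hK, Matrix.det_mul, hC, Matrix.det_submatrix_equiv_self]
    exact (Matrix.isUnit_det_J _ _).mul hBu
  obtain ⟨t, ht⟩ := exists_isUnit_add_real_smul (A := quatEmbedding n (quatPart K))
    (B := quatEmbedding n (quatPart (-Complex.I • K))) (by rwa [quatEmbedding_quatPart_add])
  have h3 := quatPart_J_mul_conjTranspose hCt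
  -- The matrix `-i C` has the same symmetry as `C`, so both quaternionic components of `K` acquire
  -- the same sign and any real combination keeps it.
  have h4 := quatPart_J_mul_conjTranspose (C := -Complex.I • C) (ε := ε)
    (by rw [Matrix.transpose_smul, hCt, smul_comm])
  rw [Matrix.mul_smul] at h4
  refine ⟨quatPart K + t • quatPart (-Complex.I • K), ?_, ?_, a, fun s hs => ?_⟩
  · have h0 (Y : Matrix (Fin n) (Fin n) (Quaternion ℝ)) : (t • Y)ᴴ = t • Yᴴ := by
      ext1 i j
      exact Quaternion.star_smul t (Y j i)
    rw [Matrix.conjTranspose_add, h3, h0, h4, smul_add, smul_comm]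
  · refine isUnit_of_isUnit_quatEmbedding ?_
    rwa [map_add, quatEmbedding_smul]
  · obtain ⟨X, hX⟩ := ha s hs
    refine ⟨X, ?_, hX⟩
    have h5 := isometryGroup_conj c (hb s hs)
    rw [show c⁻¹ * (b⁻¹ * s * b) * c = a⁻¹ * s * a by rw [hc]; group, ← hX, mem_isometryGroup,
      coe_quatInclusion, ← hB', ← hCB, Matrix.transpose_submatrix, Matrix.submatrix_mul_equiv,
      Matrix.submatrix_mul_equiv] at h5
    have h6 : (quatEmbedding n X)ᵀ * C * quatEmbedding n X = C := by
      ext i j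
      simpa using congrFun (congrFun h5 (splitEquiv hN i)) (splitEquiv hN j)
    -- Moving `J` past the transpose turns bilinear invariance of `C` into sesquilinear invariance
    -- of `K = J C`.
    have h7 : quatEmbedding n (X : Matrix (Fin n) (Fin n) (Quaternion ℝ))ᴴ * K *
        quatEmbedding n X = K := by
      rw [hK, ← Matrix.mul_assoc, ← J_mul_quatEmbedding_transpose, Matrix.mul_assoc,
        Matrix.mul_assoc, ← Matrix.mul_assoc _ C, h6]
    have h8 := quatPart_mul_mul (X : Matrix (Fin n) (Fin n) (Quaternion ℝ))ᴴ X K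
    have h9 := quatPart_mul_mul (X : Matrix (Fin n) (Fin n) (Quaternion ℝ))ᴴ X (-Complex.I • K)
    rw [h7] at h8
    rw [Matrix.mul_smul, Matrix.smul_mul, h7] at h9
    change (X : Matrix (Fin n) (Fin n) (Quaternion ℝ))ᴴ * _ * X = _
    rw [Matrix.mul_add, Matrix.add_mul, ← h8, Matrix.mul_smul, Matrix.smul_mul, ← h9]

theorem subsetInt_indefiniteSp_iff :
    (∃ (r s : ℕ) (hrs : r + s = n), SubsetInt S (indefiniteSp hrs hN)) ↔
      SubsetInt S (complexSp hN) ∧ SubsetInt S (quatGL hN) := by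
  constructor
  · rintro ⟨r, s, hrs, hS⟩
    refine ⟨?_, hS.mono (map_subset_quatGL hN _)⟩
    set I := signMatrix ℂ hrs with hI
    have hII : I * I = 1 := by
      rw [hI, signMatrix, Matrix.reindex_apply, Matrix.submatrix_mul_equiv,
        Matrix.fromBlocks_multiply]
      simp
    have hIt : Iᵀ = I := by
      rw [hI, signMatrix, Matrix.transpose_reindex, Matrix.fromBlocks_transpose]
      simp
    have hs : quatEmbedding n (signMatrix (Quaternion ℝ) hrs) = Matrix.fromBlocks I 0 0 I :=
      quatEmbedding_signMatrix hrs
    -- The form is `[0, -I; I, 0]` with `I² = 1`; rescaling the first half by `I` turns it into `J`.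
    let D : Matrix (Fin N) (Fin N) ℂ :=
      Matrix.reindexAlgEquiv ℂ ℂ (splitEquiv hN) (Matrix.fromBlocks I 0 0 1)
    have hDD : D * D = 1 := by
      rw [← map_mul, Matrix.fromBlocks_multiply]
      simp [hII]
    refine hS.conj ⟨D, D, hDD, hDD⟩ fun t ht => ?_
    have := isometryGroup_conj ⟨D, D, hDD, hDD⟩ (map_starIsometryGroup_le hN ht)
    rw [hs] at this
    have hD : Dᵀ * (Matrix.J (Fin n) ℂ * Matrix.fromBlocks I 0 0 I).submatrix
        (splitEquiv hN).symm (splitEquiv hN).symm * D = sympMatrix ℂ hN := by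
      simp only [D, Matrix.coe_reindexAlgEquiv, sympMatrix, Matrix.reindex_apply,
        Matrix.transpose_submatrix, Matrix.submatrix_mul_equiv]
      simp [Matrix.J, Matrix.fromBlocks_multiply, Matrix.fromBlocks_transpose, hII, hIt]
    rwa [hD] at this
  · rintro ⟨h₁, h₂⟩
    obtain ⟨M, hM, hu, hS⟩ := h₁.exists_quaternion_form hN (ε := -1)
      (by simpa using sympMatrix_transpose hN) (isUnit_sympMatrix hN) h₂
    obtain ⟨p, q, h, hc⟩ := quaternion_exists_starCongruent_signMatrix (by simpa using hM) hu
    exact ⟨p, q, h, hS.of_starCongruent_quaternion hN hc⟩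

theorem subsetInt_quatO_iff :
    SubsetInt S (quatO hN) ↔ SubsetInt S (complexO N) ∧ SubsetInt S (quatGL hN) := by
  constructor
  · intro hS
    refine ⟨hS.mono fun t ht => ?_, hS.mono (map_subset_quatGL hN _)⟩
    have h := map_starIsometryGroup_le hN ht
    -- The scalar matrix `j` embeds as `-J = J⁻¹`, so the associated bilinear form is already the
    -- identity and no conjugation is needed.
    have hj : Matrix.J (Fin n) ℂ * quatEmbedding n (Matrix.diagonal fun _ => quatJ) = 1 := by
      simp [quatEmbedding_diagonal_quatJ, Matrix.J, Matrix.fromBlocks_multiply]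
    rwa [hj, Matrix.submatrix_one_equiv] at h
  · rintro ⟨h₁, h₂⟩
    obtain ⟨M, hM, hu, hS⟩ := h₁.exists_quaternion_form hN (ε := 1) (by simp) isUnit_one h₂
    exact hS.of_starCongruent_quaternion hN (quaternion_starCongruent_quatJ (by simpa using hM) hu)

end Quaternion

end ClassicalEmbedding

theorem proposition5p9
    {E : Type*} [NormedAddCommGroup E] [NormedSpace ℝ E] [FiniteDimensional ℝ E]
    {L : Type*} [TopologicalSpace L] [ChartedSpace E L] [Group L] [LieGroup 𝓘(ℝ, E) ∞ L]
    (N : ℕ) (τ : L →* GL (Fin N) ℂ) (hτ : Continuous τ) :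
    ((∃ (p q : ℕ) (h : p + q = N),
        ClassicalEmbedding.SubsetInt (Set.range τ) (ClassicalEmbedding.indefiniteO h)) ↔
      ClassicalEmbedding.SubsetInt (Set.range τ) (ClassicalEmbedding.complexO N) ∧
      ClassicalEmbedding.SubsetInt (Set.range τ) (ClassicalEmbedding.realGL N)) ∧
    ∀ (n : ℕ) (hN : n + n = N),
      (ClassicalEmbedding.SubsetInt (Set.range τ) (ClassicalEmbedding.realSp hN) ↔
        ClassicalEmbedding.SubsetInt (Set.range τ) (ClassicalEmbedding.complexSp hN) ∧
        ClassicalEmbedding.SubsetInt (Set.range τ) (ClassicalEmbedding.realGL N)) ∧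
      ((∃ (r s : ℕ) (hrs : r + s = n),
          ClassicalEmbedding.SubsetInt (Set.range τ) (ClassicalEmbedding.indefiniteSp hrs hN)) ↔
        ClassicalEmbedding.SubsetInt (Set.range τ) (ClassicalEmbedding.complexSp hN) ∧
        ClassicalEmbedding.SubsetInt (Set.range τ) (ClassicalEmbedding.quatGL hN)) ∧
      (ClassicalEmbedding.SubsetInt (Set.range τ) (ClassicalEmbedding.quatO hN) ↔
        ClassicalEmbedding.SubsetInt (Set.range τ) (ClassicalEmbedding.complexO N) ∧
        ClassicalEmbedding.SubsetInt (Set.range τ) (ClassicalEmbedding.quatGL hN)) := by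
  exact ⟨ClassicalEmbedding.subsetInt_indefiniteO_iff, fun n hN =>
    ⟨ClassicalEmbedding.subsetInt_realSp_iff hN, ClassicalEmbedding.subsetInt_indefiniteSp_iff hN,
      ClassicalEmbedding.subsetInt_quatO_iff hN⟩⟩
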